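/- Let $p\ge 2$ be an integer, $\mathfrak q=e^{i\pi/p}$ and $[k]=\frac{\mathfrak q^k-\mathfrak q^{-k}}{\mathfrak q-\mathfrak q^{-1}}$. Let $\overline{U}$ be the restricted quantum group $\overline{\mathscr U}_{\mathfrak q}s\ell(2)$: the unital associative $\mathbb C$-algebra generated by $E,F,K^{\pm1}$ with the relations $KEK^{-1}=\mathfrak q^2E$, $KFK^{-1}=\mathfrak q^{-2}F$, $[E,F]=\frac{K-K^{-1}}{\mathfrak q-\mathfrak q^{-1}}$, $E^p=F^p=0$, $K^{2p}=1$. Let $\underline{\mathbb C}_{\mathfrak q}$ be the divided-power quantum plane, with basis $x^{(m)}y^{(n)}$ ($m,n\ge0$) and $\overline U$-action $$E(x^{(m)}y^{(n)})=[m+1]\,x^{(m+1)}y^{(n-1)},\quad K(x^{(m)}y^{(n)})=\mathfrak q^{m-n}x^{(m)}y^{(n)},\quad F(x^{(m)}y^{(n)})=[n+1]\,x^{(m-1)}y^{(n+1)},$$ where $x^{(-1)}=y^{(-1)}=0$. Let $(\underline{\mathbb C}_{\mathfrak q})_i$ be the span of the $x^{(m)}y^{(n)}$ with $m+n=i$,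 and $(\underline{\mathbb C}_{\mathfrak q})_{(i)}$ the span of those with $m+n\le i$; both are $\overline U$-submodules. For $\alpha=\pm$ and $1\le r\le p$, let $X^\alpha_r$ be the irreducible $\overline U$-module with basis $v_0,\dots,v_{r-1}$ and $Kv_k=\alpha\mathfrak q^{r-1-2k}v_k$, $Ev_k=\alpha[k][r-k]v_{k-1}$, $Fv_k=v_{k+1}$ (where $v_{-1}=v_r=0$). For $\alpha=\pm$, $1\le r\le p-1$ and $n\ge2$, let $W^\alpha_r(n)$ be the indecomposable "zigzag" $\overline U$-module with basis $a^i_k$ ($1\le i\le n$, $0\le k\le r-1$) and $b^i_k$ ($1\le i\le n-1$, $0\le k\le p-r-1$), in which, for each $i$, the $b^i_k$ span a copy of $X^{-\alpha}_{p-r}$ (with the formulas above), the $a^i_k$ transform by the formulas of $X^\alpha_r$ except that $F a^i_{r-1}=b^i_0$ for $i\le n-1$ and $E a^i_0=b^{i-1}_{p-r-1}$ for $i\ge2$, while $F a^n_{r-1}=0$ and $E a^1_0=0$. Then there are the following decompositions into (internal) direct sums of $\overline U$-submodules. 1. $(\underline{\mathbb C}_{\mathfrak q})_{(p-1)}=\bigoplus_{r=1}^{p}X^+_r$,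 where the summand isomorphic to $X^+_r$ lies in $(\underline{\mathbb C}_{\mathfrak q})_{r-1}$. 2. For every $n\ge2$, $$(\underline{\mathbb C}_{\mathfrak q})_{(np-1)}=(\underline{\mathbb C}_{\mathfrak q})_{((n-1)p-1)}\oplus\bigoplus_{r=1}^{p-1}W^{\alpha}_r(n)\oplus n X^{\alpha}_p,$$ where $\alpha=+$ for odd $n$ and $\alpha=-$ for even $n$, the summand isomorphic to $W^\alpha_r(n)$ lies in $(\underline{\mathbb C}_{\mathfrak q})_{(n-1)p+r-1}$, and each of the $n$ summands isomorphic to $X^\alpha_p$ lies in $(\underline{\mathbb C}_{\mathfrak q})_{np-1}$. -/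

import Mathlib

noncomputable section

namespace DPPlane

/-! ### The root of unity and the quantum integers -/

/-- The even root of unity `q = exp(iπ/p)`. -/
def q (p : ℕ) : ℂ := Complex.exp (Real.pi * Complex.I / p)

/-- The quantum integer `[k] = (q^k - q^(-k)) / (q - q⁻¹)`. -/
def qint (p : ℕ) (k : ℤ) : ℂ := (q p ^ k - q p ^ (-k)) / (q p - (q p)⁻¹)

theorem q_ne_zero (p : ℕ) : q p ≠ 0 := Complex.exp_ne_zero _

theorem q_pow_p (p : ℕ) [hp : Fact (2 ≤ p)] : q p ^ p = -1 := by
  have h := hp.out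
  have hp0 : (p : ℂ) ≠ 0 := by exact_mod_cast (by omega : p ≠ 0)
  rw [q, ← Complex.exp_nat_mul, mul_div_cancel₀ _ hp0, Complex.exp_pi_mul_I]

theorem q_pow_two_p (p : ℕ) [hp : Fact (2 ≤ p)] : q p ^ (2 * p) = 1 := by
  rw [mul_comm, pow_mul, q_pow_p]; norm_num

theorem q_sub_inv_ne_zero (p : ℕ) [hp : Fact (2 ≤ p)] : q p - (q p)⁻¹ ≠ 0 := by
  have h2 := hp.out
  have hp0 : (p : ℝ) ≠ 0 := by exact_mod_cast (by omega : p ≠ 0)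
  have hq : q p = Complex.exp (((Real.pi / p : ℝ) : ℂ) * Complex.I) := by
    rw [q]; congr 1; push_cast; ring
  have him : (q p - (q p)⁻¹).im = 2 * Real.sin (Real.pi / p) := by
    rw [hq, ← Complex.exp_neg, ← neg_mul, ← Complex.ofReal_neg, Complex.sub_im,
      Complex.exp_ofReal_mul_I_im, Complex.exp_ofReal_mul_I_im, Real.sin_neg]
    ring
  have hpos : 0 < Real.sin (Real.pi / p) := by
    have h2' : (2 : ℝ) ≤ p := by exact_mod_cast h2
    apply Real.sin_pos_of_pos_of_lt_pi
    · positivity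
    · rw [div_lt_iff₀ (by positivity)]
      nlinarith [Real.pi_pos]
  intro h0
  rw [h0] at him
  simp at him
  exact hpos.ne' him

@[simp] theorem qint_zero (p : ℕ) : qint p 0 = 0 := by simp [qint]

theorem qint_mul_sub (p : ℕ) [hp : Fact (2 ≤ p)] (a b : ℤ) :
    qint p (a + 1) * qint p b - qint p a * qint p (b + 1) = qint p (b - a) := by
  have h0 := q_ne_zero p
  have h1 := q_sub_inv_ne_zero p
  have ha : q p ^ a ≠ 0 := zpow_ne_zero _ h0
  have hb : q p ^ b ≠ 0 := zpow_ne_zero _ h0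
  unfold qint
  rw [div_mul_div_comm, div_mul_div_comm, ← sub_div, div_eq_div_iff (mul_ne_zero h1 h1) h1]
  simp only [zpow_neg, zpow_add₀ h0, zpow_sub₀ h0, zpow_one]
  generalize q p ^ a = A at *
  generalize q p ^ b = B at *
  field_simp
  ring

theorem qint_mul_p (p : ℕ) [hp : Fact (2 ≤ p)] (k : ℕ) : qint p ((p * k : ℕ) : ℤ) = 0 := by
  have h : q p ^ (p * k) = (-1) ^ k := by rw [pow_mul, q_pow_p]
  have h2 : ((-1 : ℂ) ^ k)⁻¹ = (-1) ^ k := by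
    rw [← inv_pow]; norm_num
  rw [qint, zpow_neg, zpow_natCast, h, h2, sub_self, zero_div]

/-! ### The restricted quantum group -/

/-- Names of the generators. -/
inductive UGen : Type
  | E | F | K | Kinv

open FreeAlgebra in
/-- The defining relations. -/
inductive UbarRel (p : ℕ) : FreeAlgebra ℂ UGen → FreeAlgebra ℂ UGen → Prop
  | K_Kinv : UbarRel p (ι ℂ UGen.K * ι ℂ UGen.Kinv) 1
  | Kinv_K : UbarRel p (ι ℂ UGen.Kinv * ι ℂ UGen.K) 1
  | K_E : UbarRel p (ι ℂ UGen.K * ι ℂ UGen.E * ι ℂ UGen.Kinv) (q p ^ 2 • ι ℂ UGen.E)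
  | K_F : UbarRel p (ι ℂ UGen.K * ι ℂ UGen.F * ι ℂ UGen.Kinv) ((q p ^ 2)⁻¹ • ι ℂ UGen.F)
  | E_F : UbarRel p (ι ℂ UGen.E * ι ℂ UGen.F - ι ℂ UGen.F * ι ℂ UGen.E)
      ((q p - (q p)⁻¹)⁻¹ • (ι ℂ UGen.K - ι ℂ UGen.Kinv))
  | E_pow : UbarRel p (ι ℂ UGen.E ^ p) 0
  | F_pow : UbarRel p (ι ℂ UGen.F ^ p) 0
  | K_pow : UbarRel p (ι ℂ UGen.K ^ (2 * p)) 1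

/-- The restricted quantum group `Ū_q sl(2)` (as a unital associative `ℂ`-algebra). -/
abbrev Ubar (p : ℕ) : Type := RingQuot (UbarRel p)

/-- The image of a generator in the quantum group. -/
def Ubar.gen (p : ℕ) (g : UGen) : Ubar p :=
  RingQuot.mkAlgHom ℂ (UbarRel p) (FreeAlgebra.ι ℂ g)

/-- Operators on `V` that satisfy the defining relations of `Ū_q sl(2)`. -/
structure URep (p : ℕ) (V : Type) [AddCommGroup V] [Module ℂ V] where
  op : UGen → Module.End ℂ V
  K_Kinv : op .K * op .Kinv = 1
  Kinv_K : op .Kinv * op .K = 1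
  K_E : op .K * op .E * op .Kinv = q p ^ 2 • op .E
  K_F : op .K * op .F * op .Kinv = (q p ^ 2)⁻¹ • op .F
  E_F : op .E * op .F - op .F * op .E = (q p - (q p)⁻¹)⁻¹ • (op .K - op .Kinv)
  E_pow : op .E ^ p = 0
  F_pow : op .F ^ p = 0
  K_pow : op .K ^ (2 * p) = 1

section URep

variable {p : ℕ} {V : Type} [AddCommGroup V] [Module ℂ V]

/-- The algebra homomorphism given by operators that satisfy the defining relations. -/
def URep.toAlgHom (R : URep p V) : Ubar p →ₐ[ℂ] Module.End ℂ V :=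
  RingQuot.liftAlgHom ℂ ⟨FreeAlgebra.lift ℂ R.op, by
    intro a b h
    cases h <;>
      simp only [map_mul, map_pow, map_sub, map_smul, map_one, map_zero, FreeAlgebra.lift_ι_apply]
    · exact R.K_Kinv
    · exact R.Kinv_K
    · exact R.K_E
    · exact R.K_F
    · exact R.E_F
    · exact R.E_pow
    · exact R.F_pow
    · exact R.K_pow⟩

theorem URep.toAlgHom_gen (R : URep p V) (g : UGen) : R.toAlgHom (Ubar.gen p g) = R.op g := by
  simp [URep.toAlgHom, Ubar.gen]

theorem URep.invariant (R : URep p V) (S : Submodule ℂ V)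
    (h : ∀ g, ∀ v ∈ S, R.op g v ∈ S) (u : Ubar p) : ∀ v ∈ S, R.toAlgHom u v ∈ S := by
  obtain ⟨a, rfl⟩ := RingQuot.mkAlgHom_surjective ℂ (UbarRel p) u
  induction a using FreeAlgebra.induction with
  | grade0 c =>
    intro v hv
    rw [AlgHom.commutes, AlgHom.commutes, Module.algebraMap_end_apply]
    exact S.smul_mem c hv
  | grade1 g =>
    intro v hv
    have := R.toAlgHom_gen g
    rw [Ubar.gen] at this
    rw [this]
    exact h g v hv
  | mul a b ha hb =>
    intro v hv
    rw [map_mul, map_mul, Module.End.mul_apply]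
    exact ha _ (hb v hv)
  | add a b ha hb =>
    intro v hv
    rw [map_add, map_add, LinearMap.add_apply]
    exact S.add_mem (ha v hv) (hb v hv)

end URep

section Weight

variable {I : Type}

theorem pow_eq_zero_of_height (T : Module.End ℂ (I →₀ ℂ)) (h : I → ℕ)
    (hT : ∀ i, T (Finsupp.single i 1) = 0 ∨
      ∃ (c : ℂ) (j : I), T (Finsupp.single i 1) = c • Finsupp.single j 1 ∧ h j < h i)
    (N : ℕ) (hN : ∀ i, h i < N) : T ^ N = 0 := by
  have key : ∀ N i, h i < N → (T ^ N) (Finsupp.single i 1) = 0 := by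
    intro N
    induction N with
    | zero => intro i hi; omega
    | succ N ih =>
      intro i hi
      rw [pow_succ, Module.End.mul_apply]
      rcases hT i with h0 | ⟨c, j, hj, hlt⟩
      · rw [h0, map_zero]
      · rw [hj, map_smul, ih j (by omega), smul_zero]
  apply Finsupp.lhom_ext'
  intro i
  ext
  simp [key N i (hN i)]

/-- The linear operator with prescribed values on the basis. -/
def opOf (v : I → (I →₀ ℂ)) : Module.End ℂ (I →₀ ℂ) := Finsupp.linearCombination ℂ v

@[simp] theorem opOf_single (v : I → (I →₀ ℂ)) (i : I) : opOf v (Finsupp.single i 1) = v i := by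
  simp [opOf]

/-- The diagonal operator with prescribed eigenvalues on the basis. -/
def diagOf (w : I → ℂ) : Module.End ℂ (I →₀ ℂ) := opOf fun i => w i • Finsupp.single i 1

@[simp] theorem diagOf_single (w : I → ℂ) (i : I) :
    diagOf w (Finsupp.single i 1) = w i • Finsupp.single i 1 := by
  simp only [diagOf, opOf_single]

theorem ext_single {f g : Module.End ℂ (I →₀ ℂ)}
    (h : ∀ i, f (Finsupp.single i 1) = g (Finsupp.single i 1)) : f = g := by
  apply Finsupp.lhom_ext'
  intro i
  ext1
  exact h i

/-- A representation on a space with a basis of weight vectors: `K` has eigenvalue `w i` on the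
`i`-th basis vector, which `E` and `F` map to `e i` and `f i`. -/
def URep.ofWeights (p : ℕ) (w : I → ℂ) (e f : I → (I →₀ ℂ))
    (hw : ∀ i, w i ≠ 0) (hwp : ∀ i, w i ^ (2 * p) = 1)
    (he : ∀ i, diagOf w (e i) = (q p ^ 2 * w i) • e i)
    (hf : ∀ i, diagOf w (f i) = ((q p ^ 2)⁻¹ * w i) • f i)
    (hef : ∀ i, opOf e (f i) - opOf f (e i) =
      ((q p - (q p)⁻¹)⁻¹ * (w i - (w i)⁻¹)) • Finsupp.single i 1)
    (hE : opOf e ^ p = 0) (hF : opOf f ^ p = 0) : URep p (I →₀ ℂ) where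
  op g := match g with
    | .E => opOf e
    | .F => opOf f
    | .K => diagOf w
    | .Kinv => diagOf fun i => (w i)⁻¹
  K_Kinv := ext_single fun i => by
    simp only [Module.End.mul_apply, diagOf_single, map_smul, smul_smul, Module.End.one_apply,
      inv_mul_cancel₀ (hw i), one_smul]
  Kinv_K := ext_single fun i => by
    simp only [Module.End.mul_apply, diagOf_single, map_smul, smul_smul, Module.End.one_apply,
      mul_inv_cancel₀ (hw i), one_smul]
  K_E := ext_single fun i => by
    simp only [Module.End.mul_apply, diagOf_single, map_smul, opOf_single, LinearMap.smul_apply,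
      he, smul_smul]
    congr 1
    field_simp [hw i]
  K_F := ext_single fun i => by
    simp only [Module.End.mul_apply, diagOf_single, map_smul, opOf_single, LinearMap.smul_apply,
      hf, smul_smul]
    congr 1
    field_simp [hw i]
  E_F := ext_single fun i => by
    simp only [Module.End.mul_apply, diagOf_single, opOf_single, LinearMap.smul_apply,
      LinearMap.sub_apply, hef, ← sub_smul, smul_smul]
  E_pow := hE
  F_pow := hF
  K_pow := ext_single fun i => by
    have : ∀ N : ℕ, (diagOf w ^ N) (Finsupp.single i 1) = w i ^ N • Finsupp.single i 1 := by
      intro N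
      induction N with
      | zero => simp
      | succ N ih =>
        rw [pow_succ, Module.End.mul_apply, diagOf_single, map_smul, ih, smul_smul, pow_succ,
          mul_comm]
    rw [this, hwp, one_smul, Module.End.one_apply]

end Weight

/-! ### The divided-power quantum plane -/

/-- The underlying space of the divided-power quantum plane, with the basis of divided-power
monomials `x^(m) y^(n)`, `m, n ≥ 0`. -/
def QPlane (_p : ℕ) : Type := (ℕ × ℕ) →₀ ℂ

instance (p : ℕ) : AddCommGroup (QPlane p) := inferInstanceAs (AddCommGroup ((ℕ × ℕ) →₀ ℂ))
instance (p : ℕ) : Module ℂ (QPlane p) := inferInstanceAs (Module ℂ ((ℕ × ℕ) →₀ ℂ))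

/-- The monomial `x^(m) y^(n)`. -/
def mono (p : ℕ) (m n : ℕ) : QPlane p := Finsupp.single (m, n) (1 : ℂ)

/-- `E (x^(m) y^(n)) = [m+1] x^(m+1) y^(n-1)`, where `y^(-1) = 0`. -/
def planeE (p : ℕ) (i : ℕ × ℕ) : (ℕ × ℕ) →₀ ℂ :=
  if i.2 = 0 then 0 else qint p (i.1 + 1) • Finsupp.single (i.1 + 1, i.2 - 1) 1

/-- `F (x^(m) y^(n)) = [n+1] x^(m-1) y^(n+1)`, where `x^(-1) = 0`. -/
def planeF (p : ℕ) (i : ℕ × ℕ) : (ℕ × ℕ) →₀ ℂ :=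
  if i.1 = 0 then 0 else qint p (i.2 + 1) • Finsupp.single (i.1 - 1, i.2 + 1) 1

theorem prod_qint_eq_zero (p : ℕ) [hp : Fact (2 ≤ p)] (m : ℕ) :
    ∏ k ∈ Finset.range p, qint p ((m + k : ℕ) + 1) = 0 := by
  have h2 := hp.out
  have hlt := Nat.mod_lt m (show p > 0 by omega)
  apply Finset.prod_eq_zero (i := p - 1 - m % p) (Finset.mem_range.mpr (by omega))
  have hm := Nat.div_add_mod m p
  have : (((m + (p - 1 - m % p) : ℕ) : ℤ) + 1) = ((p * (m / p + 1) : ℕ) : ℤ) := by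
    have : m + (p - 1 - m % p) + 1 = p * (m / p + 1) := by
      rw [mul_add]; omega
    exact_mod_cast this
  rw [this, qint_mul_p]

theorem planeE_pow (p : ℕ) [hp : Fact (2 ≤ p)] : opOf (planeE p) ^ p = 0 := by
  have key : ∀ k m n, (opOf (planeE p) ^ k) (Finsupp.single (m, n) 1) =
      if k ≤ n then (∏ j ∈ Finset.range k, qint p ((m + j : ℕ) + 1)) •
        Finsupp.single (m + k, n - k) 1 else 0 := by
    intro k
    induction k with
    | zero => intro m n; simp
    | succ k ih =>
      intro m n
      rw [pow_succ', Module.End.mul_apply, ih]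
      by_cases h : k + 1 ≤ n
      · rw [if_pos h, if_pos (by omega), map_smul, opOf_single, planeE, if_neg (by simp; omega),
          smul_smul, Finset.prod_range_succ]
        rfl
      · rw [if_neg h]
        split_ifs with h'
        · rw [map_smul, opOf_single, planeE, if_pos (by simp; omega), smul_zero]
        · simp
  apply ext_single
  rintro ⟨m, n⟩
  rw [key, prod_qint_eq_zero]
  simp

theorem planeF_pow (p : ℕ) [hp : Fact (2 ≤ p)] : opOf (planeF p) ^ p = 0 := by
  have key : ∀ k m n, (opOf (planeF p) ^ k) (Finsupp.single (m, n) 1) =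
      if k ≤ m then (∏ j ∈ Finset.range k, qint p ((n + j : ℕ) + 1)) •
        Finsupp.single (m - k, n + k) 1 else 0 := by
    intro k
    induction k with
    | zero => intro m n; simp
    | succ k ih =>
      intro m n
      rw [pow_succ', Module.End.mul_apply, ih]
      by_cases h : k + 1 ≤ m
      · rw [if_pos h, if_pos (by omega), map_smul, opOf_single, planeF, if_neg (by simp; omega),
          smul_smul, Finset.prod_range_succ]
        rfl
      · rw [if_neg h]
        split_ifs with h'
        · rw [map_smul, opOf_single, planeF, if_pos (by simp; omega), smul_zero]
        · simp
  apply ext_single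
  rintro ⟨m, n⟩
  rw [key, prod_qint_eq_zero]
  simp

/-- The action on the quantum plane; `K (x^(m) y^(n)) = q^(m-n) x^(m) y^(n)`. -/
def planeRep (p : ℕ) [hp : Fact (2 ≤ p)] : URep p ((ℕ × ℕ) →₀ ℂ) :=
  URep.ofWeights p (fun i => q p ^ ((i.1 : ℤ) - i.2)) (planeE p) (planeF p)
    (fun i => zpow_ne_zero _ (q_ne_zero p))
    (fun i => by
      rw [← zpow_natCast, ← zpow_mul, mul_comm, zpow_mul, zpow_natCast, q_pow_two_p, one_zpow])
    (fun i => by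
      unfold planeE
      split_ifs with h
      · simp
      · rw [map_smul, diagOf_single, smul_comm]
        congr 1
        rw [← zpow_natCast, ← zpow_add₀ (q_ne_zero p)]
        congr 2
        push_cast [Nat.cast_sub (show 1 ≤ i.2 by omega)]
        ring)
    (fun i => by
      unfold planeF
      split_ifs with h
      · simp
      · rw [map_smul, diagOf_single, smul_comm]
        congr 1
        rw [← zpow_natCast, ← zpow_neg, ← zpow_add₀ (q_ne_zero p)]
        congr 2
        push_cast [Nat.cast_sub (show 1 ≤ i.1 by omega)]
        ring)
    (fun i => by
      have h1 : opOf (planeE p) (planeF p i) =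
          (qint p (i.2 + 1) * qint p i.1) • Finsupp.single i 1 := by
        unfold planeF
        split_ifs with h
        · simp [h]
        · rw [map_smul, opOf_single, planeE, if_neg (by simp), smul_smul]
          simp only [Nat.cast_sub (show 1 ≤ i.1 by omega), Nat.cast_one, sub_add_cancel,
            Nat.sub_add_cancel (show 1 ≤ i.1 by omega), Nat.add_sub_cancel]
      have h2 : opOf (planeF p) (planeE p i) =
          (qint p i.2 * qint p (i.1 + 1)) • Finsupp.single i 1 := by
        unfold planeE
        split_ifs with h
        · simp [h]
        · rw [map_smul, opOf_single, planeF, if_neg (by simp), smul_smul, mul_comm]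
          simp only [Nat.cast_sub (show 1 ≤ i.2 by omega), Nat.cast_one, sub_add_cancel,
            Nat.sub_add_cancel (show 1 ≤ i.2 by omega), Nat.add_sub_cancel]
      rw [h1, h2, ← sub_smul, qint_mul_sub, qint, zpow_neg, div_eq_inv_mul])
    (planeE_pow p) (planeF_pow p)

instance (p : ℕ) [hp : Fact (2 ≤ p)] : Module (Ubar p) (QPlane p) :=
  Module.compHom ((ℕ × ℕ) →₀ ℂ) (planeRep p).toAlgHom.toRingHom

/-- The span (over `ℂ`) of the monomials `x^(m) y^(n)` with `m + n ∈ s`; this is a submodule. -/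
def degreeSpan (p : ℕ) [hp : Fact (2 ≤ p)] (s : Set ℕ) : Submodule (Ubar p) (QPlane p) where
  __ := (Submodule.span ℂ {v : QPlane p | ∃ m n : ℕ, m + n ∈ s ∧ v = mono p m n}).toAddSubmonoid
  smul_mem' u v hv := by
    refine (planeRep p).invariant
      (Submodule.span ℂ {v : (ℕ × ℕ) →₀ ℂ | ∃ m n : ℕ, m + n ∈ s ∧ v = mono p m n}) ?_ u v hv
    have hm : ∀ m n : ℕ, m + n ∈ s → (Finsupp.single (m, n) 1 : (ℕ × ℕ) →₀ ℂ) ∈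
        Submodule.span ℂ {v : (ℕ × ℕ) →₀ ℂ | ∃ m n : ℕ, m + n ∈ s ∧ v = mono p m n} :=
      fun m n h => Submodule.subset_span ⟨m, n, h, rfl⟩
    intro g v hv
    induction hv using Submodule.span_induction with
    | mem v hv =>
      obtain ⟨m, n, hmn, rfl⟩ := hv
      cases g
      · change opOf (planeE p) (Finsupp.single (m, n) 1) ∈ _
        rw [opOf_single, planeE]
        split_ifs with h
        · exact Submodule.zero_mem _
        · refine Submodule.smul_mem _ _ (hm _ _ ?_)
          convert hmn using 1
          simp only at h ⊢
          omega
      · change opOf (planeF p) (Finsupp.single (m, n) 1) ∈ _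
        rw [opOf_single, planeF]
        split_ifs with h
        · exact Submodule.zero_mem _
        · refine Submodule.smul_mem _ _ (hm _ _ ?_)
          convert hmn using 1
          simp only at h ⊢
          omega
      · change diagOf _ (Finsupp.single (m, n) 1) ∈ _
        rw [diagOf_single]
        exact Submodule.smul_mem _ _ (hm _ _ hmn)
      · change diagOf _ (Finsupp.single (m, n) 1) ∈ _
        rw [diagOf_single]
        exact Submodule.smul_mem _ _ (hm _ _ hmn)
    | zero => rw [map_zero]; exact Submodule.zero_mem _
    | add x y _ _ hx hy => rw [map_add]; exact Submodule.add_mem _ hx hy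
    | smul c x _ hx => rw [map_smul]; exact Submodule.smul_mem _ c hx

/-- The graded component: the span of the `x^(m) y^(n)` with `m + n = i`. -/
def grade (p : ℕ) [hp : Fact (2 ≤ p)] (i : ℕ) : Submodule (Ubar p) (QPlane p) :=
  degreeSpan p {i}

/-- The filtration: the span of the `x^(m) y^(n)` with `0 ≤ m + n ≤ i`. -/
def filt (p : ℕ) [hp : Fact (2 ≤ p)] (i : ℕ) : Submodule (Ubar p) (QPlane p) :=
  degreeSpan p (Set.Iic i)

/-! ### The irreducible modules -/

/-- A sign as a complex number. -/
def sgn (α : ℤˣ) : ℂ := ((α : ℤ) : ℂ)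

theorem sgn_mul_self (α : ℤˣ) : sgn α * sgn α = 1 := by
  rcases Int.units_eq_one_or α with rfl | rfl <;> simp [sgn]

theorem sgn_ne_zero (α : ℤˣ) : sgn α ≠ 0 := by
  rcases Int.units_eq_one_or α with rfl | rfl <;> simp [sgn]

theorem sgn_inv (α : ℤˣ) : (sgn α)⁻¹ = sgn α :=
  inv_eq_of_mul_eq_one_left (sgn_mul_self α)

@[simp] theorem sgn_neg (α : ℤˣ) : sgn (-α) = -sgn α := by simp [sgn]

/-- The weight `α q^(s-1-2k)` of the `k`-th basis vector of the irreducible module of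
dimension `s` and sign `α`. -/
def wt (p s : ℕ) (α : ℤˣ) (k : ℕ) : ℂ := sgn α * q p ^ ((s : ℤ) - 1 - 2 * k)

/-- The coefficient `α [k] [s-k]` of the action of `E` in the irreducible module of
dimension `s` and sign `α`. -/
def ecoef (p s : ℕ) (α : ℤˣ) (k : ℕ) : ℂ := sgn α * (qint p k * qint p ((s : ℤ) - k))

theorem wt_ne_zero (p s : ℕ) (α : ℤˣ) (k : ℕ) : wt p s α k ≠ 0 :=
  mul_ne_zero (sgn_ne_zero α) (zpow_ne_zero _ (q_ne_zero p))

theorem wt_pow (p s : ℕ) [hp : Fact (2 ≤ p)] (α : ℤˣ) (k : ℕ) : wt p s α k ^ (2 * p) = 1 := by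
  rw [wt, mul_pow, pow_mul (sgn α), pow_two, sgn_mul_self, one_pow, one_mul,
    ← zpow_natCast, ← zpow_mul, mul_comm, zpow_mul, zpow_natCast, q_pow_two_p, one_zpow]

theorem wt_pred (p s : ℕ) (α : ℤˣ) (k : ℕ) (hk : k ≠ 0) :
    wt p s α (k - 1) = q p ^ 2 * wt p s α k := by
  rw [wt, wt, mul_left_comm, ← zpow_natCast, ← zpow_add₀ (q_ne_zero p)]
  congr 2
  push_cast [Nat.cast_sub (show 1 ≤ k by omega)]
  ring

theorem wt_succ (p s : ℕ) (α : ℤˣ) (k : ℕ) :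
    wt p s α (k + 1) = (q p ^ 2)⁻¹ * wt p s α k := by
  rw [wt, wt, mul_left_comm, ← zpow_natCast, ← zpow_neg, ← zpow_add₀ (q_ne_zero p)]
  congr 2
  push_cast
  ring

theorem wt_last (p r : ℕ) [hp : Fact (2 ≤ p)] (α : ℤˣ) (hr : r < p) :
    wt p (p - r) (-α) (p - r - 1) = q p ^ 2 * wt p r α 0 := by
  rw [wt, wt, mul_left_comm, ← zpow_natCast (q p) 2, ← zpow_add₀ (q_ne_zero p), sgn_neg]
  have h : ((p - r : ℕ) : ℤ) - 1 - 2 * ((p - r - 1 : ℕ) : ℤ) =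
      -(p : ℤ) + (((2 : ℕ) : ℤ) + ((r : ℤ) - 1 - 2 * ((0 : ℕ) : ℤ))) := by omega
  rw [h, zpow_add₀ (q_ne_zero p), zpow_neg, zpow_natCast, q_pow_p]
  norm_num

theorem wt_first (p r : ℕ) [hp : Fact (2 ≤ p)] (α : ℤˣ) (hr : r < p) (k : ℕ) (hk : k + 1 = r) :
    wt p (p - r) (-α) 0 = (q p ^ 2)⁻¹ * wt p r α k := by
  rw [wt, wt, mul_left_comm, ← zpow_natCast (q p) 2, ← zpow_neg, ← zpow_add₀ (q_ne_zero p),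
    sgn_neg]
  have h : ((p - r : ℕ) : ℤ) - 1 - 2 * ((0 : ℕ) : ℤ) =
      (p : ℤ) + (-((2 : ℕ) : ℤ) + ((r : ℤ) - 1 - 2 * (k : ℤ))) := by omega
  rw [h, zpow_add₀ (q_ne_zero p), zpow_natCast, q_pow_p]
  norm_num

theorem ecoef_sub (p s : ℕ) [hp : Fact (2 ≤ p)] (α : ℤˣ) (k : ℕ) :
    ecoef p s α (k + 1) - ecoef p s α k =
      (q p - (q p)⁻¹)⁻¹ * (wt p s α k - (wt p s α k)⁻¹) := by
  have h := qint_mul_sub p (k : ℤ) ((s : ℤ) - k - 1)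
  rw [sub_add_cancel] at h
  rw [ecoef, ecoef, ← mul_sub, wt, mul_inv, sgn_inv, ← mul_sub]
  push_cast
  rw [← sub_sub, h, qint, ← zpow_neg, mul_left_comm, div_eq_inv_mul]
  congr 4 <;> ring

@[simp] theorem ecoef_zero (p s : ℕ) (α : ℤˣ) : ecoef p s α 0 = 0 := by simp [ecoef]

@[simp] theorem ecoef_self (p s : ℕ) (α : ℤˣ) : ecoef p s α s = 0 := by simp [ecoef]

/-- The basis vector `v k` for `0 ≤ k < r`, and `0` for other `k`. -/
def xv (r k : ℕ) : Fin r →₀ ℂ := if h : k < r then Finsupp.single ⟨k, h⟩ 1 else 0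

theorem xv_fin {r : ℕ} (k : Fin r) : xv r k = Finsupp.single k 1 := by simp [xv]

theorem xv_out {r k : ℕ} (h : ¬ k < r) : xv r k = 0 := by simp [xv, h]

/-- `E (v k) = α [k] [r-k] v (k-1)`. -/
def xE (p r : ℕ) (α : ℤˣ) (k : Fin r) : Fin r →₀ ℂ := ecoef p r α k • xv r (k - 1)

/-- `F (v k) = v (k+1)`. -/
def xF (r : ℕ) (k : Fin r) : Fin r →₀ ℂ := xv r (k + 1)

theorem opOf_xv {r : ℕ} (T : Fin r → (Fin r →₀ ℂ)) (k : ℕ) (h : k < r) :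
    opOf T (xv r k) = T ⟨k, h⟩ := by simp [xv, h]

theorem diagOf_xv {r : ℕ} (w : ℕ → ℂ) (k : ℕ) :
    diagOf (fun i : Fin r => w i) (xv r k) = w k • xv r k := by
  by_cases h : k < r <;> simp [xv, h]

theorem xE_pow (p r : ℕ) (α : ℤˣ) (hr : r ≤ p) : opOf (xE p r α) ^ p = 0 := by
  apply pow_eq_zero_of_height _ (fun k : Fin r => (k : ℕ))
  · intro k
    rw [opOf_single, xE]
    by_cases h : (k : ℕ) = 0
    · simp [h]
    · exact Or.inr ⟨_, ⟨k - 1, by omega⟩, by rw [← xv_fin], by simp only; omega⟩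
  · intro k
    omega

theorem xF_pow (p r : ℕ) (hr : r ≤ p) : opOf (xF r) ^ p = 0 := by
  apply pow_eq_zero_of_height _ (fun k : Fin r => r - 1 - (k : ℕ))
  · intro k
    rw [opOf_single, xF]
    by_cases h : (k : ℕ) + 1 < r
    · exact Or.inr ⟨1, ⟨k + 1, h⟩, by rw [← xv_fin, one_smul], by simp only; omega⟩
    · exact Or.inl (xv_out h)
  · intro k
    omega

/-- The action on the irreducible module `X^α_r`, with `K (v k) = α q^(r-1-2k) v k`. -/
def xRep (p r : ℕ) [hp : Fact (2 ≤ p)] (α : ℤˣ) (hr : r ≤ p) : URep p (Fin r →₀ ℂ) :=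
  URep.ofWeights p (fun k => wt p r α k) (xE p r α) (xF r)
    (fun k => wt_ne_zero p r α k)
    (fun k => wt_pow p r α k)
    (fun k => by
      rw [xE, map_smul, diagOf_xv (wt p r α), smul_comm]
      by_cases h : (k : ℕ) = 0
      · simp [h]
      · rw [wt_pred p r α k h])
    (fun k => by rw [xF, diagOf_xv (wt p r α), wt_succ])
    (fun k => by
      have h1 : opOf (xE p r α) (xF r k) = ecoef p r α (k + 1) • xv r k := by
        rw [xF]
        by_cases h : (k : ℕ) + 1 < r
        · rw [opOf_xv _ _ h, xE]
          simp
        · rw [xv_out h, map_zero, show (k : ℕ) + 1 = r by omega, ecoef_self, zero_smul]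
      have h2 : opOf (xF r) (xE p r α k) = ecoef p r α k • xv r k := by
        rw [xE, map_smul]
        by_cases h : (k : ℕ) = 0
        · simp [h]
        · rw [opOf_xv _ _ (show (k : ℕ) - 1 < r by omega), xF]
          simp only [Nat.sub_add_cancel (show 1 ≤ (k : ℕ) by omega)]
      rw [h1, h2, ← sub_smul, ecoef_sub, xv_fin])
    (xE_pow p r α hr) (xF_pow p r hr)

/-- The irreducible module `X^α_r` of dimension `r`, `1 ≤ r ≤ p`, with highest weight
`α q^(r-1)`. -/
def XMod (p r : ℕ) (_α : ℤˣ) (_hr : r ≤ p) : Type := Fin r →₀ ℂ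

instance (p r : ℕ) (α : ℤˣ) (hr : r ≤ p) : AddCommGroup (XMod p r α hr) :=
  inferInstanceAs (AddCommGroup (Fin r →₀ ℂ))

instance (p r : ℕ) [hp : Fact (2 ≤ p)] (α : ℤˣ) (hr : r ≤ p) :
    Module (Ubar p) (XMod p r α hr) :=
  Module.compHom (Fin r →₀ ℂ) (xRep p r α hr).toAlgHom.toRingHom

/-! ### The zigzag modules -/

/-- The index set of the basis of `W^α_r(n)`: `n` copies of the basis of `X^α_r` (on top) and
`n - 1` copies of the basis of `X^(-α)_(p-r)` (at the bottom). -/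
abbrev WIdx (p r n : ℕ) : Type := (Fin n × Fin r) ⊕ (Fin (n - 1) × Fin (p - r))

/-- The top basis vector `a i k` for `0 ≤ i < n` and `0 ≤ k < r`, and `0` for other `i`, `k`. -/
def top (p r n i k : ℕ) : WIdx p r n →₀ ℂ :=
  if h : i < n ∧ k < r then Finsupp.single (Sum.inl (⟨i, h.1⟩, ⟨k, h.2⟩)) 1 else 0

/-- The bottom basis vector `b i k` for `0 ≤ i < n - 1` and `0 ≤ k < p - r`, and `0` for other
`i`, `k`. -/
def bot (p r n i k : ℕ) : WIdx p r n →₀ ℂ :=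
  if h : i < n - 1 ∧ k < p - r then Finsupp.single (Sum.inr (⟨i, h.1⟩, ⟨k, h.2⟩)) 1 else 0

/-- The eigenvalues of `K`: `α q^(r-1-2k)` on `a i k` and `-α q^(p-r-1-2k)` on `b i k`. -/
def wWt (p r n : ℕ) (α : ℤˣ) : WIdx p r n → ℂ
  | Sum.inl (_, k) => wt p r α k
  | Sum.inr (_, k) => wt p (p - r) (-α) k

/-- `E (a i k) = α [k] [r-k] a i (k-1)` for `k > 0`, while `E (a i 0) = b (i-1) (p-r-1)` for
`i > 0` and `E (a 0 0) = 0`; moreover, `E (b i k) = -α [k] [p-r-k] b i (k-1)`. -/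
def wE (p r n : ℕ) (α : ℤˣ) : WIdx p r n → (WIdx p r n →₀ ℂ)
  | Sum.inl (i, k) =>
      if (k : ℕ) = 0 then (if (i : ℕ) = 0 then 0 else bot p r n (i - 1) (p - r - 1))
      else ecoef p r α k • top p r n i (k - 1)
  | Sum.inr (i, k) => ecoef p (p - r) (-α) k • bot p r n i (k - 1)

/-- `F (a i k) = a i (k+1)` for `k < r - 1`, while `F (a i (r-1)) = b i 0` for `i < n - 1` and
`F (a (n-1) (r-1)) = 0`; moreover, `F (b i k) = b i (k+1)`. -/
def wF (p r n : ℕ) : WIdx p r n → (WIdx p r n →₀ ℂ)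
  | Sum.inl (i, k) => if (k : ℕ) + 1 < r then top p r n i (k + 1) else bot p r n i 0
  | Sum.inr (i, k) => bot p r n i (k + 1)

section WLemmas

variable {p r n : ℕ}

theorem top_fin (i : Fin n) (k : Fin r) :
    top p r n i k = Finsupp.single (Sum.inl (i, k)) 1 := by simp [top]

theorem bot_fin (i : Fin (n - 1)) (k : Fin (p - r)) :
    bot p r n i k = Finsupp.single (Sum.inr (i, k)) 1 := by simp [bot]

theorem bot_out (i k : ℕ) (h : ¬ (i < n - 1 ∧ k < p - r)) : bot p r n i k = 0 := by
  rw [bot, dif_neg h]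

theorem opOf_top (T : WIdx p r n → (WIdx p r n →₀ ℂ)) (i k : ℕ) (hi : i < n) (hk : k < r) :
    opOf T (top p r n i k) = T (Sum.inl (⟨i, hi⟩, ⟨k, hk⟩)) := by simp [top, hi, hk]

theorem opOf_bot (T : WIdx p r n → (WIdx p r n →₀ ℂ)) (i k : ℕ) (hi : i < n - 1)
    (hk : k < p - r) :
    opOf T (bot p r n i k) = T (Sum.inr (⟨i, hi⟩, ⟨k, hk⟩)) := by simp [bot, hi, hk]

theorem diagOf_top (α : ℤˣ) (i k : ℕ) :
    diagOf (wWt p r n α) (top p r n i k) = wt p r α k • top p r n i k := by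
  by_cases h : i < n ∧ k < r
  · rw [top, dif_pos h, diagOf_single, wWt]
  · rw [top, dif_neg h, map_zero, smul_zero]

theorem diagOf_bot (α : ℤˣ) (i k : ℕ) :
    diagOf (wWt p r n α) (bot p r n i k) = wt p (p - r) (-α) k • bot p r n i k := by
  by_cases h : i < n - 1 ∧ k < p - r
  · rw [bot, dif_pos h, diagOf_single, wWt]
  · rw [bot, dif_neg h, map_zero, smul_zero]

theorem wEF_top (α : ℤˣ) (i : Fin n) (k : Fin r) :
    opOf (wE p r n α) (wF p r n (Sum.inl (i, k))) =
      ecoef p r α (k + 1) • top p r n i k := by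
  simp only [wF]
  split_ifs with h
  · rw [opOf_top _ _ _ i.2 h, wE, if_neg (by simp)]
    simp
  · rw [show (k : ℕ) + 1 = r by omega, ecoef_self, zero_smul]
    by_cases hb : (i : ℕ) < n - 1 ∧ 0 < p - r
    · rw [opOf_bot _ _ _ hb.1 hb.2, wE]
      simp
    · rw [bot_out _ _ hb, map_zero]

theorem wFE_top (α : ℤˣ) (i : Fin n) (k : Fin r) :
    opOf (wF p r n) (wE p r n α (Sum.inl (i, k))) =
      ecoef p r α k • top p r n i k := by
  simp only [wE]
  split_ifs with h h'
  · simp [h]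
  · rw [h, ecoef_zero, zero_smul]
    by_cases hb : (i : ℕ) - 1 < n - 1 ∧ p - r - 1 < p - r
    · rw [opOf_bot _ _ _ hb.1 hb.2, wF]
      exact bot_out _ _ (by simp only; omega)
    · rw [bot_out _ _ hb, map_zero]
  · rw [map_smul, opOf_top _ _ _ i.2 (show (k : ℕ) - 1 < r by omega), wF]
    simp only [Nat.sub_add_cancel (show 1 ≤ (k : ℕ) by omega)]
    rw [if_pos k.2]

theorem wEF_bot (α : ℤˣ) (i : Fin (n - 1)) (k : Fin (p - r)) :
    opOf (wE p r n α) (wF p r n (Sum.inr (i, k))) =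
      ecoef p (p - r) (-α) (k + 1) • bot p r n i k := by
  simp only [wF]
  by_cases h : (k : ℕ) + 1 < p - r
  · rw [opOf_bot _ _ _ i.2 h, wE]
    simp
  · rw [show (k : ℕ) + 1 = p - r by omega, ecoef_self, zero_smul, bot_out _ _ (by omega), map_zero]

theorem wFE_bot (α : ℤˣ) (i : Fin (n - 1)) (k : Fin (p - r)) :
    opOf (wF p r n) (wE p r n α (Sum.inr (i, k))) =
      ecoef p (p - r) (-α) k • bot p r n i k := by
  simp only [wE]
  rw [map_smul]
  by_cases h : (k : ℕ) = 0
  · simp [h]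
  · rw [opOf_bot _ _ _ i.2 (show (k : ℕ) - 1 < p - r by omega), wF]
    simp only [Nat.sub_add_cancel (show 1 ≤ (k : ℕ) by omega)]

/-- The number of times that `E` can be applied, at most. -/
def eHeight (p r n : ℕ) : WIdx p r n → ℕ
  | Sum.inl (_, k) => p - r + k
  | Sum.inr (_, k) => k

/-- The number of times that `F` can be applied, at most. -/
def fHeight (p r n : ℕ) : WIdx p r n → ℕ
  | Sum.inl (_, k) => p - 1 - k
  | Sum.inr (_, k) => p - r - 1 - k

theorem wE_pow (α : ℤˣ) (hr : r ≤ p) : opOf (wE p r n α) ^ p = 0 := by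
  apply pow_eq_zero_of_height _ (eHeight p r n)
  · rintro (⟨i, k⟩ | ⟨i, k⟩) <;> rw [opOf_single, wE]
    · split_ifs with h h'
      · exact Or.inl rfl
      · by_cases hb : (i : ℕ) - 1 < n - 1 ∧ p - r - 1 < p - r
        · exact Or.inr ⟨1, Sum.inr (⟨_, hb.1⟩, ⟨_, hb.2⟩), by rw [← bot_fin, one_smul],
            by simp only [eHeight]; omega⟩
        · exact Or.inl (bot_out _ _ hb)
      · exact Or.inr ⟨_, Sum.inl (i, ⟨k - 1, by omega⟩), by rw [← top_fin],
          by simp only [eHeight]; omega⟩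
    · by_cases h : (k : ℕ) = 0
      · simp [h]
      · exact Or.inr ⟨_, Sum.inr (i, ⟨k - 1, by omega⟩), by rw [← bot_fin],
          by simp only [eHeight]; omega⟩
  · rintro (⟨i, k⟩ | ⟨i, k⟩) <;> simp only [eHeight] <;> omega

theorem wF_pow (hr : r ≤ p) : opOf (wF p r n) ^ p = 0 := by
  apply pow_eq_zero_of_height _ (fHeight p r n)
  · rintro (⟨i, k⟩ | ⟨i, k⟩) <;> rw [opOf_single, wF]
    · split_ifs with h
      · exact Or.inr ⟨1, Sum.inl (i, ⟨k + 1, h⟩), by rw [← top_fin, one_smul],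
          by simp only [fHeight]; omega⟩
      · by_cases hb : (i : ℕ) < n - 1 ∧ 0 < p - r
        · exact Or.inr ⟨1, Sum.inr (⟨_, hb.1⟩, ⟨_, hb.2⟩), by rw [← bot_fin, one_smul],
            by simp only [fHeight]; omega⟩
        · exact Or.inl (bot_out _ _ hb)
    · by_cases h : (k : ℕ) + 1 < p - r
      · exact Or.inr ⟨1, Sum.inr (i, ⟨k + 1, h⟩), by rw [← bot_fin, one_smul],
          by simp only [fHeight]; omega⟩
      · exact Or.inl (bot_out _ _ (by omega))
  · rintro (⟨i, k⟩ | ⟨i, k⟩) <;> simp only [fHeight] <;> omega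

end WLemmas

/-- The action on `W^α_r(n)`. -/
def wRep (p r n : ℕ) [hp : Fact (2 ≤ p)] (α : ℤˣ) (hr : r ≤ p) : URep p (WIdx p r n →₀ ℂ) :=
  URep.ofWeights p (wWt p r n α) (wE p r n α) (wF p r n)
    (by rintro (⟨i, k⟩ | ⟨i, k⟩) <;> exact wt_ne_zero _ _ _ _)
    (by rintro (⟨i, k⟩ | ⟨i, k⟩) <;> exact wt_pow _ _ _ _)
    (by
      rintro (⟨i, k⟩ | ⟨i, k⟩) <;> simp only [wE, wWt]
      · split_ifs with h h'
        · simp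
        · by_cases hb : r < p
          · rw [diagOf_bot, wt_last p r α hb, h]
          · rw [bot_out _ _ (by omega), map_zero, smul_zero]
        · rw [map_smul, diagOf_top, smul_comm, wt_pred p r α k h]
      · rw [map_smul, diagOf_bot, smul_comm]
        by_cases h : (k : ℕ) = 0
        · simp [h]
        · rw [wt_pred _ _ _ k h])
    (by
      rintro (⟨i, k⟩ | ⟨i, k⟩) <;> simp only [wF, wWt]
      · split_ifs with h
        · rw [diagOf_top, wt_succ]
        · by_cases hb : r < p
          · rw [diagOf_bot, wt_first p r α hb k (by omega)]
          · rw [bot_out _ _ (by omega), map_zero, smul_zero]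
      · rw [diagOf_bot, wt_succ])
    (by
      rintro (⟨i, k⟩ | ⟨i, k⟩)
      · rw [wEF_top, wFE_top, ← sub_smul, ecoef_sub, top_fin, wWt]
      · rw [wEF_bot, wFE_bot, ← sub_smul, ecoef_sub, bot_fin, wWt])
    (wE_pow α hr) (wF_pow hr)

/-- The indecomposable zigzag module `W^α_r(n)`, `1 ≤ r ≤ p - 1`, `n ≥ 2`, with `n` copies of
`X^α_r` on top and `n - 1` copies of `X^(-α)_(p-r)` at the bottom: `F` maps the lowest-weight
vector of the `i`-th top copy to the highest-weight vector of the `i`-th bottom copy, and `E` maps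
the highest-weight vector of the `(i+1)`-st top copy to the lowest-weight vector of the `i`-th
bottom copy. -/
def WMod (p r n : ℕ) (_α : ℤˣ) (_hr : r ≤ p) : Type := WIdx p r n →₀ ℂ

instance (p r n : ℕ) (α : ℤˣ) (hr : r ≤ p) : AddCommGroup (WMod p r n α hr) :=
  inferInstanceAs (AddCommGroup (WIdx p r n →₀ ℂ))

instance (p r n : ℕ) [hp : Fact (2 ≤ p)] (α : ℤˣ) (hr : r ≤ p) :
    Module (Ubar p) (WMod p r n α hr) :=
  Module.compHom (WIdx p r n →₀ ℂ) (wRep p r n α hr).toAlgHom.toRingHom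

/-- The submodule `N` is the (internal) direct sum of the family `T` of submodules. -/
def IsDirectSum {R M I : Type} [Ring R] [AddCommGroup M] [Module R M]
    (T : I → Submodule R M) (N : Submodule R M) : Prop :=
  iSupIndep T ∧ ⨆ i, T i = N

end DPPlane

end

noncomputable section

namespace DPPlane

/-! The action preserves degree, and in degree `d` the monomials `x^(d-j) y^(j)`, `0 ≤ j ≤ d`, form
a chain: `F` goes from `j` to `j + 1` with coefficient `[j+1]`, and `E` goes back with coefficient
`[d-j]`. Since `[k] = 0` exactly when `p ∣ k`, the structure of a degree depends on where these
arrows break. Write `d + 1 = m p + r` with `1 ≤ r ≤ p`. The step between `j` and `j + 1` loses its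
`F`-arrow when `j + 1 ≡ 0` and its `E`-arrow when `j + 1 ≡ r` modulo `p`.

If `r < p`, each period of length `p` consists of `r` top positions followed by `p - r` bottom ones.
Only `F` crosses from top to bottom inside a period, and only `E` crosses back over the boundary
between periods. The last period stops after its top part, so the whole degree is one zigzag with `m
+ 1` tops; for `m = 0` it is a single irreducible module. If `r = p`, both arrows break at each
multiple of `p`, and the degree splits into `m + 1` irreducible blocks of length `p`.

To match the standard bases, the monomials are rescaled by `chain`, which turns the surviving
`F`-arrows, and the `E`-arrows between periods, into `1`. Inside a block only the product
`[j+1][d-j]` matters; `[cp+t] = (-1)^c [t]` identifies it with the coefficient of `E` in the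
irreducible module of sign `(-1)^m` or `-(-1)^m` (`ecoef_eq_mul`, `ecoef_neg_eq_mul`). All summands
are spanned by monomials, so directness reduces to partitioning exponent pairs
(`isDirectSum_of_spannedBy`). -/

/-! ### Zeros and periodicity of quantum integers -/

/-- The numerator vanishes iff `q^(2k) = 1`, and `q` is a primitive `2p`-th root of unity. -/
theorem qint_eq_zero_iff (p : ℕ) [hp : Fact (2 ≤ p)] (k : ℤ) : qint p k = 0 ↔ (p : ℤ) ∣ k := by
  have h2 := hp.out
  have hq : IsPrimitiveRoot (q p) (2 * p) := by
    have h := Complex.isPrimitiveRoot_exp (2 * p) (by omega)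
    convert h using 1
    rw [q]
    congr 1
    push_cast
    field_simp
  have h0 := q_ne_zero p
  rw [qint, div_eq_zero_iff, or_iff_left (q_sub_inv_ne_zero p), sub_eq_zero, zpow_neg,
    ← mul_eq_one_iff_eq_inv₀ (zpow_ne_zero _ h0), ← zpow_add₀ h0, hq.zpow_eq_one_iff_dvd,
    ← two_mul]
  push_cast
  exact mul_dvd_mul_iff_left two_ne_zero

theorem neg_one_zpow_inv (c : ℤ) : ((-1 : ℂ) ^ c)⁻¹ = (-1) ^ c := by
  rw [← inv_zpow]
  norm_num

theorem qint_mul_p_add (p : ℕ) [hp : Fact (2 ≤ p)] (c t : ℤ) :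
    qint p (c * p + t) = (-1) ^ c * qint p t := by
  have h0 := q_ne_zero p
  have h : q p ^ (c * p) = (-1) ^ c := by rw [mul_comm, zpow_mul, zpow_natCast, q_pow_p]
  rw [qint, qint, zpow_neg, zpow_neg, zpow_add₀ h0, h, mul_inv, neg_one_zpow_inv, ← mul_sub,
    mul_div_assoc]

theorem qint_neg (p : ℕ) (t : ℤ) : qint p (-t) = -qint p t := by
  rw [qint, qint, neg_neg, ← neg_div, neg_sub]

/-! ### Rescaled monomials of degree `d` -/

/-- The coefficients for which the monomials of degree `d` become the standard bases of the
zigzag modules and of the irreducible modules. -/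
def chain (p d : ℕ) : ℕ → ℂ
  | 0 => 1
  | j + 1 =>
      -- Away from multiples of `p` the factor `[j+1]` absorbs the coefficient of `F`. At a multiple
      -- of `p` that coefficient is zero, and the factor normalizes `E` instead. If also `p ∣ d +
      -- 1`, both arrows vanish and any nonzero factor would do.
      if p ∣ j + 1 then (if p ∣ d + 1 then chain p d j else chain p d j / qint p ((d : ℤ) - j))
      else chain p d j * qint p (j + 1)

/-- The only denominators are `[d-j]` with `p ∣ j + 1`; one of them could vanish only if `p` divided
`(d - j) + (j + 1) = d + 1`, which that branch excludes. -/
theorem chain_ne_zero (p d : ℕ) [hp : Fact (2 ≤ p)] (j : ℕ) : chain p d j ≠ 0 := by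
  induction j with
  | zero => simp [chain]
  | succ j ih =>
    rw [chain]
    split_ifs with h h'
    · exact ih
    · refine div_ne_zero ih fun h0 => h' ?_
      rw [qint_eq_zero_iff] at h0
      have := dvd_add h0 (Int.natCast_dvd_natCast.mpr h)
      push_cast at this
      rw [← add_assoc, sub_add_cancel] at this
      exact_mod_cast this
    · refine mul_ne_zero ih fun h0 => h ?_
      rw [qint_eq_zero_iff] at h0
      exact_mod_cast h0

/-- The rescaled monomial `x^(d-j) y^(j)` for `j ≤ d`, and `0` for other `j`. -/
def chainVec (p d j : ℕ) : (ℕ × ℕ) →₀ ℂ :=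
  if j ≤ d then chain p d j • Finsupp.single (d - j, j) 1 else 0

section

variable {p d : ℕ}

theorem opOf_planeE_chainVec_zero : opOf (planeE p) (chainVec p d 0) = 0 := by
  rw [chainVec, if_pos (Nat.zero_le _), map_smul, opOf_single, planeE, if_pos rfl, smul_zero]

/-- The function `f` lets one statement serve both `K` (identity) and its inverse (inversion). -/
theorem diagOf_chainVec (f : ℂ → ℂ) (j : ℕ) :
    diagOf (fun i : ℕ × ℕ => f (q p ^ ((i.1 : ℤ) - i.2))) (chainVec p d j) =
      f (q p ^ ((d : ℤ) - 2 * j)) • chainVec p d j := by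
  rw [chainVec]
  split_ifs with h
  · rw [map_smul, diagOf_single, smul_comm]
    have : (((d - j : ℕ) : ℤ) - j) = (d : ℤ) - 2 * j := by omega
    simp only [this]
  · rw [map_zero, smul_zero]

end

section

variable {p : ℕ} [hp : Fact (2 ≤ p)] {d : ℕ}

/-- No bound on `j` is needed: at `j = d` the convention `x^(-1) = 0` agrees with the zero value of
`chainVec` beyond `d`. -/
theorem opOf_planeF_chainVec (j : ℕ) :
    opOf (planeF p) (chainVec p d j) = if p ∣ j + 1 then 0 else chainVec p d (j + 1) := by
  by_cases hj : j + 1 ≤ d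
  · rw [chainVec, chainVec, if_pos (by omega), if_pos hj, map_smul, opOf_single, planeF,
      if_neg (by simp only; omega), smul_smul]
    simp only
    split_ifs with h
    · rw [(qint_eq_zero_iff p _).mpr (by exact_mod_cast h), mul_zero, zero_smul]
    · rw [chain, if_neg h, Nat.sub_sub]
  · have h1 : chainVec p d (j + 1) = 0 := if_neg hj
    rw [h1, ite_self, chainVec]
    split_ifs with h
    · rw [map_smul, opOf_single, planeF, if_pos (by simp only; omega), smul_zero]
    · exact map_zero _

/-- The coefficient is `[d-j]` times the ratio of consecutive values of `chain`. When `p ∣ j + 1`,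
the factor `[d-j]` vanishes exactly if `p ∣ d + 1`. -/
theorem opOf_planeE_chainVec_succ (j : ℕ) (hj : j < d) :
    opOf (planeE p) (chainVec p d (j + 1)) =
      (if p ∣ j + 1 then (if p ∣ d + 1 then 0 else 1)
        else qint p (j + 1) * qint p ((d : ℤ) - j)) • chainVec p d j := by
  rw [chainVec, chainVec, if_pos (show j + 1 ≤ d from hj), if_pos hj.le, map_smul, opOf_single, planeE,
    if_neg (by simp), smul_smul, smul_smul]
  simp only [Nat.add_sub_cancel]
  rw [show d - (j + 1) + 1 = d - j by omega,
    show (((d - (j + 1) : ℕ) : ℤ) + 1) = (d : ℤ) - j by omega]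
  congr 1
  rw [chain]
  have key : p ∣ j + 1 → (qint p ((d : ℤ) - j) = 0 ↔ p ∣ d + 1) := by
    intro h
    rw [qint_eq_zero_iff, ← dvd_add_left (Int.natCast_dvd_natCast.mpr h), ← Int.natCast_dvd_natCast]
    push_cast
    rw [← add_assoc, sub_add_cancel]
  split_ifs with h h'
  · rw [(key h).mpr h', mul_zero, zero_mul]
  · rw [div_mul_cancel₀ _ (fun h0 => h' ((key h).mp h0)), one_mul]
  · ring

end

/-- Commuting with the generators suffices, by induction on expressions in the free algebra. -/
theorem URep.map_toAlgHom {p : ℕ} {V V' : Type} [AddCommGroup V] [Module ℂ V] [AddCommGroup V']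
    [Module ℂ V'] (R : URep p V) (R' : URep p V') (φ : V →ₗ[ℂ] V')
    (h : ∀ g v, φ (R.op g v) = R'.op g (φ v)) (u : Ubar p) (v : V) :
    φ (R.toAlgHom u v) = R'.toAlgHom u (φ v) := by
  obtain ⟨a, rfl⟩ := RingQuot.mkAlgHom_surjective ℂ (UbarRel p) u
  induction a using FreeAlgebra.induction generalizing v with
  | grade0 c => simp only [AlgHom.commutes, Module.algebraMap_end_apply, map_smul]
  | grade1 g =>
    have h1 := R.toAlgHom_gen g
    have h2 := R'.toAlgHom_gen g
    rw [Ubar.gen] at h1 h2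
    rw [h1, h2, h]
  | mul a b ha hb =>
    rw [map_mul, map_mul, map_mul, Module.End.mul_apply, Module.End.mul_apply, ha, hb]
  | add a b ha hb => simp only [map_add, LinearMap.add_apply, ha, hb]

/-! ### Submodules spanned by monomials -/

/-- The submodule `T` is spanned by the monomials `x^(m) y^(n)` with `(m, n) ∈ S`. -/
def SpannedBy {p : ℕ} [hp : Fact (2 ≤ p)] (T : Submodule (Ubar p) (QPlane p))
    (S : Set (ℕ × ℕ)) : Prop :=
  ∀ v : (ℕ × ℕ) →₀ ℂ, (v : QPlane p) ∈ T ↔ v ∈ Finsupp.supported ℂ ℂ S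

section

variable {p : ℕ} [hp : Fact (2 ≤ p)]

theorem spannedBy_degreeSpan (s : Set ℕ) :
    SpannedBy (degreeSpan p s) {i | i.1 + i.2 ∈ s} := by
  intro v
  rw [Finsupp.supported_eq_span_single]
  have : (fun i : ℕ × ℕ => Finsupp.single i (1 : ℂ)) '' {i | i.1 + i.2 ∈ s} =
      {v : (ℕ × ℕ) →₀ ℂ | ∃ m n : ℕ, m + n ∈ s ∧ v = mono p m n} := by
    ext v
    constructor
    · rintro ⟨⟨m, n⟩, h, rfl⟩
      exact ⟨m, n, h, rfl⟩
    · rintro ⟨m, n, h, rfl⟩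
      exact ⟨(m, n), h, rfl⟩
  rw [this]
  rfl

theorem SpannedBy.le {T T' : Submodule (Ubar p) (QPlane p)} {S S' : Set (ℕ × ℕ)}
    (h : SpannedBy T S) (h' : SpannedBy T' S') (hS : S ⊆ S') : T ≤ T' :=
  fun v hv => (h' v).mpr (Finsupp.supported_mono hS ((h v).mp hv))

/-- Reduces a direct sum decomposition to a partition of the set of exponents. -/
theorem isDirectSum_of_spannedBy {I : Type} {T : I → Submodule (Ubar p) (QPlane p)}
    {N : Submodule (Ubar p) (QPlane p)} {S : I → Set (ℕ × ℕ)} {S' : Set (ℕ × ℕ)}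
    (hT : ∀ i, SpannedBy (T i) (S i)) (hN : SpannedBy N S')
    (hdisj : ∀ a i j, a ∈ S i → a ∈ S j → i = j) (hS : ∀ a, a ∈ S' ↔ ∃ i, a ∈ S i) :
    IsDirectSum T N := by
  constructor
  · intro i
    rw [Submodule.disjoint_def]
    intro v hv hv'
    -- Every other summand is supported off `S i`, hence so is their supremum.
    have hv2 : v ∈ Finsupp.supported ℂ ℂ (S i)ᶜ := by
      rw [iSup_subtype'] at hv'
      clear hv
      induction hv' using Submodule.iSup_induction' with
      | mem j x hx =>
        refine Finsupp.supported_mono ?_ ((hT j x).mp hx)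
        intro a ha ha'
        exact j.2 (hdisj a _ _ ha ha')
      | zero => exact Submodule.zero_mem _
      | add x y _ _ hx hy => exact Submodule.add_mem _ hx hy
    exact Submodule.disjoint_def.mp
      (Finsupp.disjoint_supported_supported disjoint_compl_right) v ((hT i v).mp hv) hv2
  · apply le_antisymm
    · exact iSup_le fun i => (hT i).le hN fun a ha => (hS a).mpr ⟨i, ha⟩
    · intro v hv
      have hv' := (hN v).mp hv
      have hsum : (v : (ℕ × ℕ) →₀ ℂ).sum Finsupp.single = v := Finsupp.sum_single v
      rw [← hsum]
      refine Submodule.sum_mem (⨆ i, T i) fun a ha => ?_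
      obtain ⟨i, hi⟩ := (hS a).mp (hv' ha)
      exact (le_iSup T i) ((hT i _).mpr (Finsupp.single_mem_supported ℂ _ hi))

/-- A representation with a basis that is mapped equivariantly to multiples of distinct monomials
is isomorphic to the span of these monomials. -/
theorem exists_spannedBy {I : Type} (R : URep p (I →₀ ℂ)) (idx : I → ℕ × ℕ)
    (hidx : Function.Injective idx) (c : I → ℂ) (hc : ∀ i, c i ≠ 0)
    (h : ∀ g i, Finsupp.linearCombination ℂ (fun i => c i • Finsupp.single (idx i) (1 : ℂ))
        (R.op g (Finsupp.single i 1)) = (planeRep p).op g (c i • Finsupp.single (idx i) 1)) :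
    let _ : Module (Ubar p) (I →₀ ℂ) := Module.compHom (I →₀ ℂ) R.toAlgHom.toRingHom
    ∃ T : Submodule (Ubar p) (QPlane p), SpannedBy T (Set.range idx) ∧
      Nonempty (T ≃ₗ[Ubar p] (I →₀ ℂ)) := by
  let : Module (Ubar p) (I →₀ ℂ) := Module.compHom (I →₀ ℂ) R.toAlgHom.toRingHom
  set φ := Finsupp.linearCombination ℂ (fun i => c i • Finsupp.single (idx i) (1 : ℂ)) with hφ
  have hs : ∀ i, φ (Finsupp.single i 1) = c i • Finsupp.single (idx i) 1 := by simp [hφ]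
  -- Distinct monomials do not interfere, so the coordinates of `v` can be recovered from `φ v`;
  -- this gives injectivity.
  have happ : ∀ v i, φ v (idx i) = c i * v i := by
    intro v i
    induction v using Finsupp.induction_linear with
    | zero => simp
    | add x y hx hy => simp only [map_add, Finsupp.add_apply, hx, hy, mul_add]
    | single j b =>
      rw [hφ, Finsupp.linearCombination_single]
      simp only [Finsupp.smul_apply, smul_eq_mul, Finsupp.single_apply (a := idx j)]
      split_ifs with hji
      · rw [hidx hji, Finsupp.single_eq_same]
        ring
      · rw [Finsupp.single_eq_of_ne (fun hij => hji (congrArg idx hij.symm)), mul_zero, mul_zero,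
          mul_zero]
  have hinj : Function.Injective φ := by
    intro v v' hv
    ext i
    have := happ v i
    rw [hv, happ] at this
    exact (mul_left_cancel₀ (hc i) this).symm
  have heq : ∀ g v, φ (R.op g v) = (planeRep p).op g (φ v) := by
    intro g v
    have : φ ∘ₗ R.op g = (planeRep p).op g ∘ₗ φ := by
      apply Finsupp.lhom_ext'
      intro i
      ext1
      simp only [LinearMap.comp_apply, Finsupp.lsingle_apply, h, hs]
    exact LinearMap.congr_fun this v
  let ψ : (I →₀ ℂ) →ₗ[Ubar p] QPlane p :=
    { toFun := φ
      map_add' := map_add φ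
      map_smul' := fun u v => R.map_toAlgHom (planeRep p) φ heq u v }
  refine ⟨LinearMap.range ψ, ?_, ⟨(LinearEquiv.ofInjective ψ hinj).symm⟩⟩
  intro v
  have h1 : (v : QPlane p) ∈ LinearMap.range ψ ↔ v ∈ LinearMap.range φ := Iff.rfl
  rw [h1, Finsupp.supported_eq_span_single]
  constructor
  · rintro ⟨x, rfl⟩
    induction x using Finsupp.induction_linear with
    | zero => simp
    | add x y hx hy => rw [map_add]; exact Submodule.add_mem _ (hx Iff.rfl) (hy Iff.rfl)
    | single j b =>
      rw [hφ, Finsupp.linearCombination_single]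
      exact Submodule.smul_mem _ _ (Submodule.smul_mem _ _
        (Submodule.subset_span ⟨_, ⟨j, rfl⟩, rfl⟩))
  · intro hv
    refine Submodule.span_le.mpr ?_ hv
    rintro _ ⟨_, ⟨j, rfl⟩, rfl⟩
    refine ⟨(c j)⁻¹ • Finsupp.single j 1, ?_⟩
    rw [map_smul, hs, smul_smul, inv_mul_cancel₀ (hc j), one_smul]

end

end DPPlane

end

noncomputable section

namespace DPPlane

/-! ### Identification of the blocks in degree `d = m p + r - 1` -/

theorem sgn_neg_one_pow (m : ℕ) : sgn ((-1) ^ m) = (-1) ^ m := by simp [sgn]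

theorem dvd_mul_add_iff (p i k : ℕ) : p ∣ i * p + k ↔ p ∣ k :=
  Nat.dvd_add_right (Dvd.intro_left i rfl)

section

variable {p : ℕ} [hp : Fact (2 ≤ p)] {d m r : ℕ}

theorem neg_one_zpow_mul_sub (m i : ℕ) :
    (-1 : ℂ) ^ (i : ℤ) * (-1) ^ ((m : ℤ) - i) = (-1) ^ m := by
  rw [← zpow_add₀ (by norm_num), add_sub_cancel, zpow_natCast]

/-- The two exponents differ by `p (m - 2i)`, which contributes the sign `(-1)^m` because `q^p =
-1`. -/
theorem wt_eq_zpow (hd : d + 1 = m * p + r) (i k : ℕ) :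
    wt p r ((-1) ^ m) k = q p ^ ((d : ℤ) - 2 * ((i * p + k : ℕ) : ℤ)) := by
  have h0 := q_ne_zero p
  have hd' : (d : ℤ) + 1 = m * p + r := by exact_mod_cast hd
  have : (d : ℤ) - 2 * ((i * p + k : ℕ) : ℤ) =
      p * ((m : ℤ) - 2 * i) + ((r : ℤ) - 1 - 2 * k) := by
    push_cast
    linear_combination hd'
  have hm : (-1 : ℂ) ^ ((m : ℤ) - 2 * i) = (-1) ^ m := by
    rw [zpow_sub₀ (by norm_num), zpow_mul, zpow_natCast]
    norm_num
  rw [wt, this, zpow_add₀ h0, zpow_mul, zpow_natCast, q_pow_p, sgn_neg_one_pow, hm]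

/-- A bottom position is a top position with index shifted to `r + k`; the leftover factor `q^p =
-1` flips the sign. -/
theorem wt_neg_eq_zpow (hd : d + 1 = m * p + r) (hr : r ≤ p) (i k : ℕ) :
    wt p (p - r) (-(-1) ^ m) k = q p ^ ((d : ℤ) - 2 * ((i * p + (r + k) : ℕ) : ℤ)) := by
  rw [← wt_eq_zpow hd i (r + k), wt, wt, sgn_neg]
  have : ((p - r : ℕ) : ℤ) - 1 - 2 * k = p + ((r : ℤ) - 1 - 2 * ((r + k : ℕ) : ℤ)) := by omega
  rw [this, zpow_add₀ (q_ne_zero p), zpow_natCast, q_pow_p]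
  ring

/-- Removing multiples of `p` from the two quantum integers costs `(-1)^i` and `(-1)^(m-i)`, whose
product does not depend on `i`. The index `k` may run past the top block, which the bottom case
exploits. -/
theorem ecoef_eq_mul (hd : d + 1 = m * p + r) (i k : ℕ) :
    ecoef p r ((-1) ^ m) (k + 1) =
      qint p (((i * p + k : ℕ) : ℤ) + 1) * qint p ((d : ℤ) - ((i * p + k : ℕ) : ℤ)) := by
  have hd' : (d : ℤ) + 1 = m * p + r := by exact_mod_cast hd
  have h1 : ((i * p + k : ℕ) : ℤ) + 1 = (i : ℤ) * p + ((k + 1 : ℕ) : ℤ) := by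
    push_cast
    ring
  have h2 : (d : ℤ) - ((i * p + k : ℕ) : ℤ) =
      ((m : ℤ) - i) * p + ((r : ℤ) - ((k + 1 : ℕ) : ℤ)) := by
    push_cast
    linear_combination hd'
  rw [h1, h2, qint_mul_p_add, qint_mul_p_add, ecoef, sgn_neg_one_pow, ← neg_one_zpow_mul_sub m i]
  ring

theorem ecoef_neg_eq_mul (hd : d + 1 = m * p + r) (hr : r ≤ p) (i k : ℕ) :
    ecoef p (p - r) (-(-1) ^ m) (k + 1) =
      qint p (((i * p + (r + k) : ℕ) : ℤ) + 1) *
        qint p ((d : ℤ) - ((i * p + (r + k) : ℕ) : ℤ)) := by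
  have h1 : ((p - r : ℕ) : ℤ) - ((k + 1 : ℕ) : ℤ) = 1 * p + -((r + k + 1 : ℕ) : ℤ) := by omega
  have h2 : (r : ℤ) - ((r + k + 1 : ℕ) : ℤ) = -((k + 1 : ℕ) : ℤ) := by omega
  rw [← ecoef_eq_mul hd i (r + k), ecoef, ecoef, sgn_neg, h1, h2, qint_mul_p_add, qint_neg,
    qint_neg, zpow_one]
  ring

theorem opOf_planeE_chainVec_mul_add (i k : ℕ) (h : i * p + k < d) (hk : k + 1 < p) :
    opOf (planeE p) (chainVec p d (i * p + (k + 1))) =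
      (qint p (((i * p + k : ℕ) : ℤ) + 1) * qint p ((d : ℤ) - ((i * p + k : ℕ) : ℤ))) •
        chainVec p d (i * p + k) := by
  rw [← add_assoc, opOf_planeE_chainVec_succ _ h, if_neg]
  rw [add_assoc, dvd_mul_add_iff]
  exact Nat.not_dvd_of_pos_of_lt (by omega) hk

theorem opOf_planeF_chainVec_mul_add (i k : ℕ) (hk : k + 1 < p) :
    opOf (planeF p) (chainVec p d (i * p + k)) = chainVec p d (i * p + (k + 1)) := by
  rw [opOf_planeF_chainVec, if_neg, add_assoc]
  rw [add_assoc, dvd_mul_add_iff]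
  exact Nat.not_dvd_of_pos_of_lt (by omega) hk

theorem opOf_planeF_chainVec_last (i k : ℕ) (hk : k + 1 = p) :
    opOf (planeF p) (chainVec p d (i * p + k)) = 0 := by
  rw [opOf_planeF_chainVec, if_pos]
  rw [add_assoc, dvd_mul_add_iff, hk]

/-- The boundary between two periods: this arrow of `E` links a zigzag, and its absence when `p ∣ d
+ 1` separates the irreducible blocks. -/
theorem opOf_planeE_chainVec_first (i : ℕ) (h : (i + 1) * p ≤ d) :
    opOf (planeE p) (chainVec p d ((i + 1) * p)) =
      (if p ∣ d + 1 then 0 else 1) • chainVec p d (i * p + (p - 1)) := by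
  have h2 := hp.out
  have : (i + 1) * p = i * p + (p - 1) + 1 := by
    rw [add_mul]
    omega
  rw [this, opOf_planeE_chainVec_succ _ (by omega), if_pos]
  · split_ifs <;> simp
  · exact ⟨i + 1, by rw [← this, mul_comm]⟩

/-- A block of consecutive monomials of degree `d` that spans an irreducible submodule. -/
theorem exists_XMod (hd : d + 1 = m * p + r) (hr0 : 0 < r) (hr : r ≤ p) (i : ℕ) (hi : i ≤ m)
    (h : r = p ∨ m = 0) :
    ∃ T : Submodule (Ubar p) (QPlane p),
      SpannedBy T {a | a.1 + a.2 = d ∧ i * p ≤ a.2 ∧ a.2 < i * p + r} ∧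
      Nonempty (T ≃ₗ[Ubar p] XMod p r ((-1) ^ m) hr) := by
  have him : i * p ≤ m * p := Nat.mul_le_mul_right p hi
  have hvec : ∀ k : Fin r, chainVec p d (i * p + k) =
      chain p d (i * p + k) • Finsupp.single (d - (i * p + k), i * p + (k : ℕ)) 1 :=
    fun k => if_pos (by omega)
  have hφ : ∀ k, Finsupp.linearCombination ℂ (fun k : Fin r => chain p d (i * p + k) •
      Finsupp.single (d - (i * p + k), i * p + (k : ℕ)) (1 : ℂ)) (xv r k) =
      if k < r then chainVec p d (i * p + k) else 0 := by
    intro k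
    rw [xv]
    split_ifs with hk
    · rw [Finsupp.linearCombination_single, one_smul, hvec ⟨k, hk⟩]
    · exact map_zero _
  obtain ⟨T, hT, e⟩ := exists_spannedBy (xRep p r ((-1) ^ m) hr)
    (fun k => (d - (i * p + k), i * p + (k : ℕ)))
    (fun k l hkl => by
      have := congrArg Prod.snd hkl
      simp only at this
      omega)
    (fun k => chain p d (i * p + k)) (fun k => chain_ne_zero p d _)
    (by
      intro g k
      rw [← hvec]
      cases g
      · change _ = opOf (planeE p) _
        rw [show (xRep p r ((-1) ^ m) hr).op .E = opOf (xE p r ((-1) ^ m)) from rfl, opOf_single, xE,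
          map_smul, hφ]
        obtain ⟨_ | k, hk⟩ := k
        · simp only [ecoef_zero, zero_smul]
          -- Left edge of the block: either it is the start of the chain, or `r = p` and `E`
          -- vanishes there since `p ∣ d + 1`.
          rcases i with _ | i
          · simp only [zero_mul, zero_add, opOf_planeE_chainVec_zero]
          · rcases h with rfl | rfl
            · rw [add_zero, opOf_planeE_chainVec_first _ (by omega),
                if_pos ⟨m + 1, by rw [hd]; ring⟩, zero_smul]
            · omega
        · simp only [Nat.add_sub_cancel]
          rw [if_pos (by omega), opOf_planeE_chainVec_mul_add _ _ (by omega) (by omega),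
            ecoef_eq_mul hd i]
      · change _ = opOf (planeF p) _
        rw [show (xRep p r ((-1) ^ m) hr).op .F = opOf (xF r) from rfl, opOf_single, xF, hφ]
        split_ifs with hk
        · rw [opOf_planeF_chainVec_mul_add _ _ (by omega)]
        -- Right edge: for `r = p` the coefficient of `F` vanishes at a multiple of `p`; for `m = 0`
        -- the chain ends, as `d = r - 1`.
        · rcases h with rfl | rfl
          · rw [opOf_planeF_chainVec_last _ _ (by omega)]
          · have : i = 0 := by omega
            subst this
            rw [opOf_planeF_chainVec, chainVec, if_neg (show ¬ 0 * p + (k : ℕ) + 1 ≤ d by omega), ite_self]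
      · change _ = diagOf (fun i : ℕ × ℕ => id (q p ^ ((i.1 : ℤ) - i.2))) _
        rw [diagOf_chainVec]
        rw [show (xRep p r ((-1) ^ m) hr).op .K = diagOf (fun k : Fin r => wt p r ((-1) ^ m) k) from
          rfl, diagOf_single, map_smul, ← xv_fin, hφ, if_pos k.2, wt_eq_zpow hd i]
        rfl
      · change _ = diagOf (fun i : ℕ × ℕ => (q p ^ ((i.1 : ℤ) - i.2))⁻¹) _
        rw [diagOf_chainVec (fun x => x⁻¹)]
        rw [show (xRep p r ((-1) ^ m) hr).op .Kinv =
          diagOf (fun k : Fin r => (wt p r ((-1) ^ m) k)⁻¹) from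
          rfl, diagOf_single, map_smul, ← xv_fin, hφ, if_pos k.2, wt_eq_zpow hd i])
  refine ⟨T, ?_, e⟩
  convert hT using 1
  ext ⟨a, b⟩
  constructor
  · rintro ⟨h1, h2, h3⟩
    simp only at h1 h2 h3
    refine ⟨⟨b - i * p, by omega⟩, ?_⟩
    simp only [Prod.mk.injEq]
    omega
  · rintro ⟨k, hk⟩
    simp only [Prod.mk.injEq] at hk
    simp only [Set.mem_ofPred_eq]
    omega

/-- The monomials of degree `d = m p + r - 1`, `1 ≤ r ≤ p - 1`, span a zigzag module. -/
theorem exists_WMod (hd : d + 1 = m * p + r) (hr0 : 0 < r) (hr : r < p) :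
    ∃ T : Submodule (Ubar p) (QPlane p), SpannedBy T {a | a.1 + a.2 = d} ∧
      Nonempty (T ≃ₗ[Ubar p] WMod p r (m + 1) ((-1) ^ m) hr.le) := by
  have hmul : ∀ i, i ≤ m → i * p ≤ m * p := fun i hi => Nat.mul_le_mul_right p hi
  have hmul' : ∀ i, i < m → i * p + p ≤ m * p := fun i hi => by
    rw [← Nat.succ_mul]
    exact Nat.mul_le_mul_right p hi
  have hdvd : ¬ p ∣ d + 1 := by
    rw [hd, dvd_mul_add_iff]
    exact Nat.not_dvd_of_pos_of_lt hr0 hr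
  -- Exponent of `y` for each basis vector: period `i` holds the `i`-th top block and then the
  -- `i`-th bottom block.
  let pos : WIdx p r (m + 1) → ℕ := Sum.elim (fun x => x.1 * p + x.2) fun x => x.1 * p + (r + x.2)
  have hpos : ∀ x, pos x ≤ d := by
    rintro (⟨i, k⟩ | ⟨i, k⟩)
    · have := hmul i (by omega)
      simp only [pos, Sum.elim_inl]
      omega
    · have := hmul' i (by omega)
      simp only [pos, Sum.elim_inr]
      omega
  have hdm : ∀ i k : ℕ, k < p → (i * p + k) / p = i ∧ (i * p + k) % p = k := fun i k hk =>
    ⟨by rw [mul_comm, Nat.mul_add_div (by omega), Nat.div_eq_of_lt hk, add_zero],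
      by rw [mul_comm, Nat.mul_add_mod, Nat.mod_eq_of_lt hk]⟩
  have hinj : Function.Injective pos := by
    have key : ∀ i k j l : ℕ, k < p → l < p → i * p + k = j * p + l → i = j ∧ k = l := by
      intro i k j l hk hl h
      have h1 := hdm i k hk
      have h2 := hdm j l hl
      rw [h] at h1
      exact ⟨h1.1.symm.trans h2.1, h1.2.symm.trans h2.2⟩
    rintro (⟨i, k⟩ | ⟨i, k⟩) (⟨j, l⟩ | ⟨j, l⟩) h <;> simp only [pos, Sum.elim_inl, Sum.elim_inr] at h <;>
      obtain ⟨h1, h2⟩ := key _ _ _ _ (by omega) (by omega) h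
    · rw [Fin.ext h1, Fin.ext h2]
    · omega
    · omega
    · rw [Fin.ext h1, Fin.ext (Nat.add_left_cancel h2)]
  have hvec : ∀ x, chainVec p d (pos x) = chain p d (pos x) • Finsupp.single (d - pos x, pos x) 1 :=
    fun x => if_pos (hpos x)
  set φ := Finsupp.linearCombination ℂ
    (fun x => chain p d (pos x) • Finsupp.single (d - pos x, pos x) (1 : ℂ)) with hφ
  have htop : ∀ i k, φ (top p r (m + 1) i k) =
      if i < m + 1 ∧ k < r then chainVec p d (i * p + k) else 0 := by
    intro i k
    rw [top]
    split_ifs with h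
    · rw [hφ, Finsupp.linearCombination_single, one_smul, ← hvec]
      rfl
    · exact map_zero _
  have hbot : ∀ i k, φ (bot p r (m + 1) i k) =
      if i < m ∧ k < p - r then chainVec p d (i * p + (r + k)) else 0 := by
    intro i k
    rw [bot]
    simp only [Nat.add_sub_cancel]
    split_ifs with h
    · rw [hφ, Finsupp.linearCombination_single, one_smul, ← hvec]
      rfl
    · exact map_zero _
  have hwt : ∀ x, wWt p r (m + 1) ((-1) ^ m) x = q p ^ ((d : ℤ) - 2 * (pos x : ℤ)) := by
    rintro (⟨i, k⟩ | ⟨i, k⟩)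
    · exact wt_eq_zpow hd i k
    · exact wt_neg_eq_zpow hd hr.le i k
  have hsingle : ∀ x, φ (Finsupp.single x 1) = chainVec p d (pos x) := fun x => by
    rw [hφ, Finsupp.linearCombination_single, one_smul, ← hvec]
  obtain ⟨T, hT, e⟩ := exists_spannedBy (wRep p r (m + 1) ((-1) ^ m) hr.le)
    (fun x => (d - pos x, pos x)) (fun x y hxy => hinj (congrArg Prod.snd hxy))
    (fun x => chain p d (pos x)) (fun x => chain_ne_zero p d _)
    (by
      intro g x
      rw [← hφ, ← hvec]
      cases g
      · change φ (opOf (wE p r (m + 1) ((-1) ^ m)) _) = opOf (planeE p) _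
        rw [opOf_single]
        obtain ⟨⟨i, hi⟩, ⟨_ | k, hk⟩⟩ | ⟨⟨i, hi⟩, ⟨_ | k, hk⟩⟩ := x <;>
          simp only [wE, pos, Sum.elim_inl, Sum.elim_inr]
        · rcases i with _ | i
          · simp only [if_true, map_zero, zero_mul, zero_add, opOf_planeE_chainVec_zero]
          · have := hmul (i + 1) (by omega)
            rw [if_pos trivial, if_neg (by omega), Nat.add_sub_cancel, hbot, if_pos (by omega),
              add_zero, opOf_planeE_chainVec_first _ (by omega), if_neg hdvd, one_smul]
            congr 2
            omega
        · have := hmul i (by omega)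
          rw [if_neg (by omega), map_smul, htop, Nat.add_sub_cancel, if_pos (by omega),
            opOf_planeE_chainVec_mul_add _ _ (by omega) (by omega), ecoef_eq_mul hd i]
        -- `E` does not lead from the start of a bottom block into the top block: the coefficient is
        -- the formula for `X_r` continued to index `r`, where `[r-r] = 0`.
        · have := hmul' i (by omega)
          obtain ⟨s, rfl⟩ : ∃ s, r = s + 1 := ⟨r - 1, by omega⟩
          rw [ecoef_zero, zero_smul, map_zero, add_zero,
            opOf_planeE_chainVec_mul_add _ _ (by omega) (by omega), ← ecoef_eq_mul hd i,
            ecoef_self, zero_smul]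
        · have := hmul' i (by omega)
          rw [map_smul, hbot, Nat.add_sub_cancel, if_pos (by omega), ← add_assoc r,
            opOf_planeE_chainVec_mul_add _ _ (by omega) (by omega),
            ecoef_neg_eq_mul hd hr.le i]
      · change φ (opOf (wF p r (m + 1)) _) = opOf (planeF p) _
        rw [opOf_single]
        obtain ⟨⟨i, hi⟩, ⟨k, hk⟩⟩ | ⟨⟨i, hi⟩, ⟨k, hk⟩⟩ := x <;>
          simp only [wF, pos, Sum.elim_inl, Sum.elim_inr]
        · rw [opOf_planeF_chainVec_mul_add _ _ (by omega)]
          split_ifs with h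
          · rw [htop, if_pos (by omega)]
          · rw [hbot, show r + 0 = k + 1 by omega]
            split_ifs with h'
            · rfl
            -- The end of the last top block is `j = d`, so the next vector is zero by the
            -- convention in `chainVec`.
            · have : i = m := by omega
              subst this
              rw [chainVec, if_neg (by omega)]
        · rw [hbot]
          split_ifs with h
          · rw [opOf_planeF_chainVec_mul_add _ _ (by omega), add_assoc]
          · rw [opOf_planeF_chainVec_last _ _ (by omega)]
      · change φ (diagOf (wWt p r (m + 1) ((-1) ^ m)) _) =
          diagOf (fun i : ℕ × ℕ => id (q p ^ ((i.1 : ℤ) - i.2))) _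
        rw [diagOf_chainVec, diagOf_single, map_smul, hsingle, hwt]
        rfl
      · change φ (diagOf (fun x => (wWt p r (m + 1) ((-1) ^ m) x)⁻¹) _) =
          diagOf (fun i : ℕ × ℕ => (q p ^ ((i.1 : ℤ) - i.2))⁻¹) _
        rw [diagOf_chainVec (fun x => x⁻¹), diagOf_single, map_smul, hsingle, hwt])
  refine ⟨T, ?_, e⟩
  convert hT using 1
  ext ⟨a, b⟩
  constructor
  · intro h
    simp only [Set.mem_ofPred_eq] at h
    -- Division of `b` by `p` gives the period, and comparing the remainder with `r` decides between
    -- top and bottom.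
    suffices ∃ x, pos x = b by
      obtain ⟨x, rfl⟩ := this
      refine ⟨x, ?_⟩
      simp only [Prod.mk.injEq, and_true]
      omega
    have hmod := Nat.mod_lt b (show p > 0 by omega)
    have hb : b / p * p + b % p = b := Nat.div_add_mod' b p
    have hle : b / p ≤ m := by
      by_contra! hlt
      have : (m + 1) * p ≤ b / p * p := Nat.mul_le_mul_right p hlt
      rw [add_mul] at this
      omega
    by_cases hbr : b % p < r
    · exact ⟨Sum.inl (⟨b / p, by omega⟩, ⟨b % p, hbr⟩), hb⟩
    -- Period `m` has no bottom block, because `b ≤ d = m p + r - 1`.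
    · have hlt : b / p < m := by
        refine lt_of_le_of_ne hle fun heq => ?_
        rw [heq] at hb
        omega
      refine ⟨Sum.inr (⟨b / p, by omega⟩, ⟨b % p - r, by omega⟩), ?_⟩
      simp only [pos, Sum.elim_inr]
      omega
  · rintro ⟨x, hx⟩
    have := hpos x
    simp only [Prod.mk.injEq] at hx
    simp only [Set.mem_ofPred_eq]
    omega

end

end DPPlane

end

/-! ### Assembly of the degrees into the filtration -/

theorem lemma1 (p : ℕ) [hp : Fact (2 ≤ p)] :
    (∃ X : Set.Icc 1 p → Submodule (DPPlane.Ubar p) (DPPlane.QPlane p),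
      (∀ r : Set.Icc 1 p, X r ≤ DPPlane.grade p (r - 1) ∧
        Nonempty (X r ≃ₗ[DPPlane.Ubar p] DPPlane.XMod p r 1 r.2.2)) ∧
      DPPlane.IsDirectSum X (DPPlane.filt p (p - 1))) ∧
    ∀ n : ℕ, 2 ≤ n → ∀ α : ℤˣ, α = (if Odd n then 1 else -1) →
      ∃ (W : Set.Ico 1 p → Submodule (DPPlane.Ubar p) (DPPlane.QPlane p))
        (X : Fin n → Submodule (DPPlane.Ubar p) (DPPlane.QPlane p)),
        (∀ r : Set.Ico 1 p, W r ≤ DPPlane.grade p ((n - 1) * p + r - 1) ∧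
          Nonempty (W r ≃ₗ[DPPlane.Ubar p] DPPlane.WMod p r n α r.2.2.le)) ∧
        (∀ j : Fin n, X j ≤ DPPlane.grade p (n * p - 1) ∧
          Nonempty (X j ≃ₗ[DPPlane.Ubar p] DPPlane.XMod p p α le_rfl)) ∧
        DPPlane.IsDirectSum
          (Sum.elim (fun _ : Unit => DPPlane.filt p ((n - 1) * p - 1)) (Sum.elim W X))
          (DPPlane.filt p (n * p - 1)) := by
  have h2 := hp.out
  constructor
  · have hX : ∀ r : Set.Icc 1 p, ∃ T : Submodule (DPPlane.Ubar p) (DPPlane.QPlane p),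
        DPPlane.SpannedBy T {a | a.1 + a.2 = r - 1 ∧ 0 * p ≤ a.2 ∧ a.2 < 0 * p + (r : ℕ)} ∧
        Nonempty (T ≃ₗ[DPPlane.Ubar p] DPPlane.XMod p r 1 r.2.2) := fun r => by
      have h1 := r.2.1
      -- For `m = 0` the single block `i = 0` fills degree `r - 1`.
      exact DPPlane.exists_XMod (m := 0) (by omega) (by omega) r.2.2 0 le_rfl (Or.inr rfl)
    choose X hX e using hX
    refine ⟨X, fun r => ⟨(hX r).le (DPPlane.spannedBy_degreeSpan _) fun a ha => ha.1, e r⟩,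
      DPPlane.isDirectSum_of_spannedBy hX (DPPlane.spannedBy_degreeSpan _) ?_ ?_⟩
    · rintro a ⟨r, hr⟩ ⟨s, hs⟩ ⟨h3, -⟩ ⟨h4, -⟩
      simp only [Set.mem_Icc] at hr hs h3 h4
      simp only [Subtype.mk.injEq]
      omega
    · rintro ⟨a, b⟩
      simp only [Set.mem_ofPred_eq, Set.mem_Iic]
      constructor
      · intro h
        exact ⟨⟨a + b + 1, by simp only [Set.mem_Icc]; omega⟩, by simp only; omega⟩
      · rintro ⟨⟨r, hr⟩, h⟩
        simp only [Set.mem_Icc] at hr h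
        omega
  · intro n hn α hα
    obtain ⟨m, rfl⟩ : ∃ m, n = m + 1 := ⟨n - 1, by omega⟩
    have hα' : α = (-1) ^ m := by
      rw [hα]
      split_ifs with h
      · exact (Even.neg_one_pow (by simpa [Nat.odd_add_one] using h)).symm
      · exact (Odd.neg_one_pow (by simpa [Nat.odd_add_one] using h)).symm
    subst hα'
    simp only [Nat.add_sub_cancel]
    have hmp : (m + 1) * p = m * p + p := Nat.succ_mul m p
    have hW : ∀ r : Set.Ico 1 p, ∃ T : Submodule (DPPlane.Ubar p) (DPPlane.QPlane p),
        DPPlane.SpannedBy T {a | a.1 + a.2 = m * p + r - 1} ∧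
        Nonempty (T ≃ₗ[DPPlane.Ubar p] DPPlane.WMod p r (m + 1) ((-1) ^ m) r.2.2.le) := fun r => by
      have h1 := r.2.1
      exact DPPlane.exists_WMod (by omega) (by omega) r.2.2
    have hX : ∀ j : Fin (m + 1), ∃ T : Submodule (DPPlane.Ubar p) (DPPlane.QPlane p),
        DPPlane.SpannedBy T
          {a | a.1 + a.2 = (m + 1) * p - 1 ∧ (j : ℕ) * p ≤ a.2 ∧ a.2 < (j : ℕ) * p + p} ∧
        Nonempty (T ≃ₗ[DPPlane.Ubar p] DPPlane.XMod p p ((-1) ^ m) le_rfl) := fun j =>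
      -- Degree `(m + 1) p - 1` is the case `r = p`, with one block for each `j ≤ m`.
      DPPlane.exists_XMod (m := m) (by omega) (by omega) le_rfl j (by omega) (Or.inl rfl)
    choose W hW eW using hW
    choose X hX eX using hX
    refine ⟨W, X,
      fun r => ⟨(hW r).le (DPPlane.spannedBy_degreeSpan _) fun a ha => ha, eW r⟩,
      fun j => ⟨(hX j).le (DPPlane.spannedBy_degreeSpan _) fun a ha => ha.1, eX j⟩,
      DPPlane.isDirectSum_of_spannedBy (S := Sum.elim (fun _ => {a | a.1 + a.2 ∈ Set.Iic (m * p - 1)})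
        (Sum.elim (fun r => {a | a.1 + a.2 = m * p + r - 1}) fun j =>
          {a | a.1 + a.2 = (m + 1) * p - 1 ∧ (j : ℕ) * p ≤ a.2 ∧ a.2 < (j : ℕ) * p + p}))
        ?_ (DPPlane.spannedBy_degreeSpan _) ?_ ?_⟩
    · rintro (_ | r | j)
      · exact DPPlane.spannedBy_degreeSpan _
      · exact hW r
      · exact hX j
    -- Since `n ≥ 2`, `m p` is positive and `m p - 1` is not truncated; otherwise degree `0` would
    -- be counted twice.
    · have hm0 : p ≤ m * p := Nat.le_mul_of_pos_left p (by omega)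
      have hlt : ∀ (b : ℕ) (i j : Fin (m + 1)), (i : ℕ) * p ≤ b → b < (j : ℕ) * p + p → i ≤ j := by
        intro b i j h3 h4
        rw [← Nat.succ_mul] at h4
        exact Nat.lt_succ_iff.mp (Nat.lt_of_mul_lt_mul_right (h3.trans_lt h4))
      have hIco : ∀ r : Set.Ico 1 p, 1 ≤ (r : ℕ) ∧ (r : ℕ) < p := fun r => r.2
      rintro ⟨a, b⟩ (_ | r | i) (_ | s | j) h3 h4 <;>
        simp only [Sum.elim_inl, Sum.elim_inr, Set.mem_ofPred_eq, Set.mem_Iic] at h3 h4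
      · rfl
      · have := hIco s
        omega
      · omega
      · have := hIco r
        omega
      · have := hIco r
        have := hIco s
        rw [show r = s from Subtype.ext (by omega)]
      · have := hIco r
        omega
      · omega
      · have := hIco s
        omega
      · rw [le_antisymm (hlt b i j h3.2.1 h4.2.2) (hlt b j i h4.2.1 h3.2.2)]
    · have hm0 : p ≤ m * p := Nat.le_mul_of_pos_left p (by omega)
      rintro ⟨a, b⟩
      simp only [Sum.exists, Sum.elim_inl, Sum.elim_inr, Set.mem_ofPred_eq, Set.mem_Iic]
      constructor
      · intro h
        rcases Nat.lt_or_ge (a + b) (m * p) with h3 | h3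
        · exact Or.inl ⟨(), by omega⟩
        · rcases Nat.lt_or_ge (a + b) ((m + 1) * p - 1) with h4 | h4
          -- The witness solves `a + b = m p + r - 1` for `r`.
          · exact Or.inr (Or.inl ⟨⟨a + b + 1 - m * p, by simp only [Set.mem_Ico]; omega⟩,
              by simp only; omega⟩)
          · have hmod := Nat.mod_lt b (show p > 0 by omega)
            have hb := Nat.div_add_mod' b p
            have hlt : b / p < m + 1 := (Nat.div_lt_iff_lt_mul (by omega)).mpr (by omega)
            exact Or.inr (Or.inr ⟨⟨b / p, hlt⟩, by simp only; omega⟩)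
      · rintro (⟨_, h⟩ | ⟨⟨r, hr⟩, h⟩ | ⟨j, h, -⟩)
        · omega
        · simp only [Set.mem_Ico] at hr h
          omega
        · omega
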